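/- **Setting.** Let $k$ be an infinite field, $R=k[x_1,\dots,x_r]$ with its standard grading, and $S=k[y_1,\dots,y_r]$. Let $R$ act on $S$ in one of the following two ways: - by *differentiation*, $x_i$ acting as $\partial/\partial y_i$; in this case assume $\operatorname{char} k=0$ or $\operatorname{char} k>e$, where $e$ is the socle degree fixed below; - by *contraction*, $x^a\circ y^b=y^{b-a}$ if $a\le b$ componentwise and $x^a\circ y^b=0$ otherwise ($\operatorname{char} k$ arbitrary; here $y^b$ stands for the divided power monomial). For a homogeneous ideal $I\subseteq R$ with $A=R/I$ artinian, the *$h$-vector* of $A$ is $h_i=\dim_k A_i$, the *socle degree* of $A\ne0$ is the largest $e$ with $A_e\neq 0$, and the *socle* of $A$ is $\operatorname{soc}(A)=\{a\in A: a\,\bar x_i=0 \text{ for all } i\}$. The algebra $A$ is *level of type $t$* if $\dim_k\operatorname{soc}(A)_e=t$ and $\operatorname{soc}(A)_i=0$ for $i\ne e$, and *Gorenstein* if it is level of type $1$. Let $I^{-1}=\{G\in S:\varphi\circ G=0\text{ for all }\varphi\in I\}$, and for $G\in S$ let $\operatorname{Ann}(G)=\{\varphi\in R:\varphi\circ G=0\}$.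 **Generic Gorenstein quotients.** Let $A=R/I$ be a level algebra of socle degree $e$ and type $t$ with $h$-vector $h=(1,h_1,\dots,h_e)$, and let $F_1,\dots,F_t$ be a $k$-basis of the degree $e$ component of $I^{-1}$. A sequence $H=(H_u)_{u\ge0}$ is called an *$h$-vector of the generic Gorenstein quotient* of $A$ of socle degree $e$ if there is a nonempty Zariski open subset $U\subseteq\mathbf P^{t-1}(k)$ such that, for every $p=[p_1:\dots:p_t]\in U$, the algebra $R/\operatorname{Ann}(p_1F_1+\dots+p_tF_t)$ is a Gorenstein quotient of $A$ of socle degree $e$ with $h$-vector $H$. **Corollary 2.5.** In this setting there is exactly one such sequence, $H^{1,\mathrm{gen}}$, and for every $u\in\{1,\dots,e\}$ $$H_u^{1,\mathrm{gen}}\;\ge\;\frac{1}{t+1}\left(h_{e-u}+h_u\right).$$ -/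

import Mathlib

open MvPolynomial

noncomputable section

namespace LevelAlgebra

/-- The two standard actions of `R = k[x_1, …, x_r]` on `S = k[y_1, …, y_r]` used for inverse
systems: partial differentiation, and contraction (where `S` is thought of as the divided power
module, the monomials `y^b` standing for the divided powers). -/
inductive ActionKind : Type
  | differentiation
  | contraction

/-- The scalar `c` in `x^a ∘ y^b = c • y^(b - a)`. For differentiation it is
`∏ i, b_i (b_i - 1) ⋯ (b_i - a_i + 1)`, for contraction it is `1`; in both cases it is `0` unless
`a ≤ b`. -/
def ActionKind.weight (k : Type*) [Field k] {r : ℕ} (w : ActionKind) (a b : Fin r →₀ ℕ) : k :=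
  match w with
  | .differentiation => ∏ i, ((b i).descFactorial (a i) : k)
  | .contraction => ∏ i, (if a i ≤ b i then 1 else 0 : k)

/-- The `k`-bilinear action `R × S → S`, determined by `x^a ∘ y^b = weight a b • y^(b - a)`. -/
def act {k : Type*} [Field k] {r : ℕ} (w : ActionKind) :
    MvPolynomial (Fin r) k →ₗ[k] MvPolynomial (Fin r) k →ₗ[k] MvPolynomial (Fin r) k :=
  (basisMonomials (Fin r) k).constr k fun a =>
    (basisMonomials (Fin r) k).constr k fun b => monomial (b - a) (w.weight k a b)

theorem act_monomial {k : Type*} [Field k] {r : ℕ} (w : ActionKind) (a b : Fin r →₀ ℕ) :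
    act w (monomial a (1 : k)) (monomial b (1 : k)) = monomial (b - a) (w.weight k a b) := by
  have h1 := (basisMonomials (Fin r) k).constr_basis k
    (fun a => (basisMonomials (Fin r) k).constr k fun b => monomial (b - a) (w.weight k a b)) a
  have h2 := (basisMonomials (Fin r) k).constr_basis k
    (fun b => monomial (b - a) (w.weight k a b)) b
  simp only [coe_basisMonomials] at h1 h2
  rw [act, h1, h2]

theorem ActionKind.weight_add (k : Type*) [Field k] {r : ℕ} (w : ActionKind)
    (a a' b : Fin r →₀ ℕ) :
    w.weight k (a + a') b = w.weight k a' b * w.weight k a (b - a') := by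
  cases w
  · simp only [ActionKind.weight, ← Finset.prod_mul_distrib]
    refine Finset.prod_congr rfl fun i _ => ?_
    rw [← Nat.cast_mul]
    congr 1
    simp only [Finsupp.coe_add, Pi.add_apply, Finsupp.coe_tsub, Pi.sub_apply]
    induction a i with
    | zero => simp
    | succ n ih =>
      rw [add_right_comm, Nat.descFactorial_succ, Nat.descFactorial_succ, ih,
        show b i - (n + a' i) = b i - a' i - n by omega]
      ring
  · simp only [ActionKind.weight, ← Finset.prod_mul_distrib]
    refine Finset.prod_congr rfl fun i _ => ?_
    simp only [Finsupp.coe_add, Pi.add_apply, Finsupp.coe_tsub, Pi.sub_apply]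
    by_cases h1 : a' i ≤ b i <;> by_cases h2 : a i ≤ b i - a' i
    · simp [h1, h2, show a i + a' i ≤ b i by omega]
    · simp [h2, show ¬ a i + a' i ≤ b i by omega]
    · simp [h1, show ¬ a i + a' i ≤ b i by omega]
    · simp [h1, show ¬ a i + a' i ≤ b i by omega]

/-- The action makes `S` an `R`-module. -/
theorem act_mul {k : Type*} [Field k] {r : ℕ} (w : ActionKind) (φ ψ G : MvPolynomial (Fin r) k) :
    act w (φ * ψ) G = act w φ (act w ψ G) := by
  induction φ using MvPolynomial.induction_on' with
  | add p q hp hq => rw [add_mul, map_add, map_add, LinearMap.add_apply, hp, hq,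
      LinearMap.add_apply]
  | monomial a c =>
  induction ψ using MvPolynomial.induction_on' with
  | add p q hp hq => rw [mul_add, map_add, map_add, LinearMap.add_apply, hp, hq,
      LinearMap.add_apply, map_add]
  | monomial a' c' =>
  induction G using MvPolynomial.induction_on' with
  | add p q hp hq => simp only [map_add, hp, hq]
  | monomial b d =>
  have hm (s : Fin r →₀ ℕ) (x : k) : monomial s x = x • monomial s (1 : k) := by
    rw [smul_monomial, smul_eq_mul, mul_one]
  rw [monomial_mul, hm _ (c * c'), hm a c, hm a' c', hm b d]
  simp only [map_smul, LinearMap.smul_apply, act_monomial]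
  rw [hm (b - a'), map_smul, act_monomial, ActionKind.weight_add, hm (b - a' - a),
    hm (b - (a + a')), tsub_tsub, add_comm a' a]
  simp only [smul_smul]
  congr 1
  ring

/-- For `ActionKind.differentiation`, the variable `x_i` acts as `∂/∂y_i`. -/
theorem act_X_differentiation {k : Type*} [Field k] {r : ℕ} (i : Fin r)
    (G : MvPolynomial (Fin r) k) :
    act .differentiation (X i) G = pderiv i G := by
  induction G using MvPolynomial.induction_on' with
  | add p q hp hq => rw [map_add, map_add, hp, hq]
  | monomial b d =>
  have hm : monomial b d = d • monomial b (1 : k) := by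
    rw [smul_monomial, smul_eq_mul, mul_one]
  rw [hm, map_smul, X, act_monomial, Derivation.map_smul, pderiv_monomial, one_mul, ActionKind.weight,
    Finset.prod_eq_single i (fun j _ hj => by simp [hj.symm]) (by simp)]
  simp

section Algebra

attribute [local instance] MvPolynomial.gradedAlgebra

variable {k : Type*} [Field k] {r : ℕ}

/-- The degree `i` component `A_i` of the algebra `A = R / I`. -/
def gradedPiece (I : Ideal (MvPolynomial (Fin r) k)) (i : ℕ) :
    Submodule k (MvPolynomial (Fin r) k ⧸ I) :=
  (homogeneousSubmodule (Fin r) k i).map (Ideal.Quotient.mkₐ k I).toLinearMap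

/-- The `h`-vector `i ↦ dim_k A_i` of `A = R / I`. -/
def hVector (I : Ideal (MvPolynomial (Fin r) k)) (i : ℕ) : ℕ :=
  Module.finrank k (gradedPiece I i)

/-- The socle of `A = R / I`: the annihilator of the maximal homogeneous ideal
`(x̄_1, …, x̄_r)`. -/
def socle (I : Ideal (MvPolynomial (Fin r) k)) : Submodule k (MvPolynomial (Fin r) k ⧸ I) where
  carrier := {a | ∀ m ∈ Ideal.span (Set.range fun i => Ideal.Quotient.mk I (X i)), a * m = 0}
  add_mem' ha hb m hm := by rw [add_mul, ha m hm, hb m hm, add_zero]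
  zero_mem' m _ := zero_mul m
  smul_mem' c a ha m hm := by rw [smul_mul_assoc, ha m hm, smul_zero]

/-- The socle-vector `i ↦ dim_k soc(A)_i` of `A = R / I`. -/
def socleVector (I : Ideal (MvPolynomial (Fin r) k)) (i : ℕ) : ℕ :=
  Module.finrank k (socle I ⊓ gradedPiece I i : Submodule k (MvPolynomial (Fin r) k ⧸ I))

/-- `R / I` is a standard graded artinian level algebra of socle degree `e` and type `t`. -/
structure IsLevel (I : Ideal (MvPolynomial (Fin r) k)) (e t : ℕ) : Prop where
  homogeneous : I.IsHomogeneous (homogeneousSubmodule (Fin r) k)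
  artinian : IsArtinianRing (MvPolynomial (Fin r) k ⧸ I)
  hVector_pos : 0 < hVector I e
  hVector_eq_zero : ∀ i, e < i → hVector I i = 0
  socleVector_eq : ∀ i, socleVector I i = if i = e then t else 0

/-- Gorenstein means level of type `1`. -/
def IsGorenstein (I : Ideal (MvPolynomial (Fin r) k)) (e : ℕ) : Prop :=
  IsLevel I e 1

/-- The inverse system `I⁻¹`: the elements of `S` annihilated by `I`. -/
def inverseSystem (w : ActionKind) (I : Ideal (MvPolynomial (Fin r) k)) :
    Submodule k (MvPolynomial (Fin r) k) where
  carrier := {G | ∀ φ ∈ I, act w φ G = 0}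
  add_mem' ha hb φ hφ := by rw [map_add, ha φ hφ, hb φ hφ, add_zero]
  zero_mem' φ _ := map_zero _
  smul_mem' c a ha φ hφ := by rw [map_smul, ha φ hφ, smul_zero]

/-- The degree `e` component of the inverse system `I⁻¹`. -/
def inverseSystemPart (w : ActionKind) (I : Ideal (MvPolynomial (Fin r) k)) (e : ℕ) :
    Submodule k (MvPolynomial (Fin r) k) :=
  inverseSystem w I ⊓ homogeneousSubmodule (Fin r) k e

/-- The annihilator `Ann(G) ⊆ R` of `G ∈ S`, that is, of the `R`-submodule generated by `G`. -/
def ann (w : ActionKind) (G : MvPolynomial (Fin r) k) : Ideal (MvPolynomial (Fin r) k) where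
  carrier := {φ | act w φ G = 0}
  add_mem' {a b} ha hb := by
    change act w (a + b) G = 0
    rw [map_add, LinearMap.add_apply, ha, hb, add_zero]
  zero_mem' := by
    change act w 0 G = 0
    rw [map_zero, LinearMap.zero_apply]
  smul_mem' c a ha := by
    change act w (c * a) G = 0
    rw [act_mul, ha, map_zero]

end Algebra

/-- Zariski open subsets of `ℙ^(t-1)(k)`: complements of the common zero loci of sets of
homogeneous polynomials. -/
def IsZariskiOpen {k : Type*} [Field k] {t : ℕ} (U : Set (Projectivization k (Fin t → k))) :
    Prop :=
  ∃ T : Set (MvPolynomial (Fin t) k), (∀ g ∈ T, ∃ d, g.IsHomogeneous d) ∧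
    U = {p | ∃ g ∈ T, eval p.rep g ≠ 0}

/-- The form `p_1 F_1 + ⋯ + p_t F_t` (well defined up to a nonzero scalar) attached to the point
`p` of `ℙ^(t-1)(k)`. -/
def formAt {k : Type*} [Field k] {r t : ℕ} (F : Fin t → MvPolynomial (Fin r) k)
    (p : Projectivization k (Fin t → k)) : MvPolynomial (Fin r) k :=
  ∑ j, p.rep j • F j

/-- `H` is the `h`-vector of the generic Gorenstein quotients of `R / I` of socle degree `e`: there
is a nonempty Zariski open subset `U` of `ℙ^(t-1)(k)` such that, for all points `p` of `U`, the
algebra `R / Ann(p_1 F_1 + ⋯ + p_t F_t)` is a Gorenstein quotient of `R / I` of socle degree `e`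
with `h`-vector `H`. -/
def IsGenericGorensteinHVector {k : Type*} [Field k] {r t : ℕ} (w : ActionKind)
    (I : Ideal (MvPolynomial (Fin r) k)) (e : ℕ) (F : Fin t → MvPolynomial (Fin r) k)
    (H : ℕ → ℕ) : Prop :=
  ∃ U : Set (Projectivization k (Fin t → k)), IsZariskiOpen U ∧ U.Nonempty ∧
    ∀ p ∈ U, I ≤ ann w (formAt F p) ∧ IsGorenstein (ann w (formAt F p)) e ∧
      ∀ u, hVector (ann w (formAt F p)) u = H u

end LevelAlgebra

end

/-!
By Macaulay duality the `h`-vector of `R / Ann(G)` in degree `u` is the rank of the catalecticant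
map `R_u → S`, `φ ↦ φ ∘ G`. As `G` runs over the span of `F_1, …, F_t`, these maps form a linear
system; their common kernel is `I_u`, and their images together span a space in perfect pairing with
`A_{e-u}`, so the inequality is one about the largest rank in a linear system of maps `V → W`.

If `g` has that rank, no member of the pencil spanned by `g` and another member `f` has larger
rank. As `k` is infinite, this forces `f (ker g) ⊆ im g` and `f u ∈ im g` for all `u` with
`g u ∈ f (ker g)`, so `dim f (ker g)` plus the rank of `f` modulo `im g` is at most the rank of `g`.
Summing over `t - 1` members which together with `g` span the system, and adding
`dim V = dim (ker g) + rank g` and `dim (im g) = rank g`, bounds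
`dim V - dim (common kernel) + dim (sum of the images)` by `t + 1` times the largest rank.
-/

namespace LevelAlgebra

section Generic

variable {k ι : Type*} [Field k]

/-- The filter of properties of the vectors `p : ι → k` that hold for general `p`, that is, off the
zero locus of a nonzero polynomial. The polynomial is required to be homogeneous so that these
properties hold on a nonempty open subset of projective space, see `exists_isZariskiOpen`. -/
def generic (k ι : Type*) [Field k] : Filter (ι → k) where
  sets := {s | ∃ D : MvPolynomial ι k, D ≠ 0 ∧ (∃ d, D.IsHomogeneous d) ∧
    ∀ p, eval p D ≠ 0 → p ∈ s}
  univ_sets := ⟨1, one_ne_zero, ⟨0, isHomogeneous_one ι k⟩, fun _ _ => trivial⟩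
  sets_of_superset := fun ⟨D, hD₀, hD, h⟩ hst => ⟨D, hD₀, hD, fun p hp => hst (h p hp)⟩
  inter_sets := by
    rintro s s' ⟨D, hD₀, ⟨d, hD⟩, h⟩ ⟨D', hD₀', ⟨d', hD'⟩, h'⟩
    refine ⟨D * D', mul_ne_zero hD₀ hD₀', ⟨d + d', hD.mul hD'⟩, fun p hp => ?_⟩
    rw [map_mul, mul_ne_zero_iff] at hp
    exact ⟨h p hp.1, h' p hp.2⟩

theorem eventually_generic_iff {P : (ι → k) → Prop} :
    (∀ᶠ p in generic k ι, P p) ↔ ∃ D : MvPolynomial ι k, D ≠ 0 ∧ (∃ d, D.IsHomogeneous d) ∧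
      ∀ p, eval p D ≠ 0 → P p :=
  Iff.rfl

theorem eventually_generic_eval_ne_zero {D : MvPolynomial ι k} {d : ℕ} (hD : D.IsHomogeneous d)
    (hD₀ : D ≠ 0) : ∀ᶠ p in generic k ι, eval p D ≠ 0 :=
  ⟨D, hD₀, ⟨d, hD⟩, fun _ => id⟩

theorem eventually_generic_apply_ne_zero (i : ι) : ∀ᶠ p in generic k ι, p i ≠ 0 := by
  simpa only [eval_X] using eventually_generic_eval_ne_zero (isHomogeneous_X k i) (X_ne_zero i)

instance generic_neBot [Infinite k] : (generic k ι).NeBot := by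
  refine ⟨fun h => ?_⟩
  obtain ⟨D, hD₀, -, hD⟩ := eventually_generic_iff.1 (Filter.empty_mem_iff_bot.2 h)
  exact hD₀ (MvPolynomial.funext fun p => by rw [map_zero]; exact not_not.1 (hD p))

end Generic

section Semicontinuity

open Module

theorem isHomogeneous_det {R n σ : Type*} [CommRing R] [Fintype n] [DecidableEq n]
    {M : Matrix n n (MvPolynomial σ R)} {d : ℕ} (hM : ∀ a b, (M a b).IsHomogeneous d) :
    M.det.IsHomogeneous (Fintype.card n * d) := by
  rw [Matrix.det_apply]
  refine IsHomogeneous.sum _ _ _ fun τ _ => ?_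
  rw [Units.smul_def, ← Int.cast_smul_eq_zsmul R]
  refine (homogeneousSubmodule σ R _).smul_mem _ ?_
  simpa using IsHomogeneous.prod Finset.univ _ (fun _ => d) fun b _ => hM (τ b) b

variable {k ι V W : Type*} [Field k] [Fintype ι] [AddCommGroup V] [Module k V]
  [FiniteDimensional k V] [AddCommGroup W] [Module k W]

theorem eventually_generic_det_ne_zero {n : Type*} [Fintype n] [DecidableEq n]
    (M : ι → Matrix n n k) {p₀ : ι → k} (h₀ : (∑ j, p₀ j • M j).det ≠ 0) :
    ∀ᶠ p in generic k ι, (∑ j, p j • M j).det ≠ 0 := by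
  let N : Matrix n n (MvPolynomial ι k) := Matrix.of fun a b => ∑ j, C (M j a b) * X j
  have eval_det (p : ι → k) : eval p N.det = (∑ j, p j • M j).det := by
    rw [RingHom.map_det]
    congr 1
    ext a b
    simp [N, Matrix.sum_apply, mul_comm]
  have hN : N.det.IsHomogeneous _ := isHomogeneous_det fun a b =>
    IsHomogeneous.sum _ _ _ fun j _ => isHomogeneous_C_mul_X (M j a b) j
  simp only [← eval_det] at h₀ ⊢
  exact eventually_generic_eval_ne_zero hN fun h => h₀ (by rw [h, map_zero])

theorem eventually_generic_linearMap_det_ne_zero (f : ι → End k V) {p₀ : ι → k}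
    (h₀ : LinearMap.det (∑ j, p₀ j • f j) ≠ 0) :
    ∀ᶠ p in generic k ι, LinearMap.det (∑ j, p j • f j) ≠ 0 := by
  have toMatrix_sum (p : ι → k) : LinearMap.det (∑ j, p j • f j) =
      (∑ j, p j • LinearMap.toMatrix (finBasis k V) (finBasis k V) (f j)).det := by
    rw [← LinearMap.det_toMatrix (finBasis k V), map_sum]
    simp only [map_smul]
  simp only [toMatrix_sum] at h₀ ⊢
  exact eventually_generic_det_ne_zero _ h₀

theorem eventually_finrank_range_le (f : ι → V →ₗ[k] W) (p₀ : ι → k) :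
    ∀ᶠ p in generic k ι, finrank k (LinearMap.range (∑ j, p₀ j • f j)) ≤
      finrank k (LinearMap.range (∑ j, p j • f j)) := by
  set g := ∑ j, p₀ j • f j with hg
  obtain ⟨A, hA⟩ := g.rangeRestrict.exists_rightInverse_of_surjective g.range_rangeRestrict
  obtain ⟨B, hB⟩ := g.range.subtype.exists_leftInverse_of_injective g.range.ker_subtype
  have compress_sum (p : ι → k) : ∑ j, p j • (B ∘ₗ f j ∘ₗ A) = B ∘ₗ (∑ j, p j • f j) ∘ₗ A := by
    ext; simp
  have compress_g : B ∘ₗ g ∘ₗ A = LinearMap.id := calc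
    B ∘ₗ g ∘ₗ A = (B ∘ₗ g.range.subtype) ∘ₗ (g.rangeRestrict ∘ₗ A) := rfl
    _ = LinearMap.id := by rw [hA, hB, LinearMap.id_comp]
  have h := eventually_generic_linearMap_det_ne_zero (fun j => B ∘ₗ f j ∘ₗ A) (p₀ := p₀) (by
    rw [compress_sum, ← hg, compress_g, LinearMap.det_id]
    exact one_ne_zero)
  filter_upwards [h] with p hp
  rw [compress_sum] at hp
  have hsurj : LinearMap.range (B ∘ₗ (∑ j, p j • f j) ∘ₗ A) = ⊤ :=
    LinearMap.range_eq_top.2 (LinearMap.equivOfDetNeZero _ hp).surjective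
  calc finrank k g.range
      = finrank k (LinearMap.range (B ∘ₗ (∑ j, p j • f j) ∘ₗ A)) := by rw [hsurj, finrank_top]
    _ ≤ finrank k (LinearMap.range (B ∘ₗ ∑ j, p j • f j)) :=
      Submodule.finrank_mono (LinearMap.range_comp_le_range A (B ∘ₗ ∑ j, p j • f j))
    _ ≤ finrank k (LinearMap.range (∑ j, p j • f j)) := by
      rw [LinearMap.range_comp]
      exact Submodule.finrank_map_le _ _

/-- The largest rank of a member of the linear system of maps spanned by the `f j`. -/
noncomputable def maxRank (f : ι → V →ₗ[k] W) : ℕ :=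
  ⨆ p : ι → k, finrank k (LinearMap.range (∑ j, p j • f j))

theorem bddAbove_finrank_range (f : ι → V →ₗ[k] W) :
    BddAbove (Set.range fun p : ι → k => finrank k (LinearMap.range (∑ j, p j • f j))) :=
  ⟨finrank k V, Set.forall_mem_range.2 fun _ => LinearMap.finrank_range_le _⟩

theorem finrank_range_le_maxRank (f : ι → V →ₗ[k] W) (p : ι → k) :
    finrank k (LinearMap.range (∑ j, p j • f j)) ≤ maxRank f :=
  le_ciSup (bddAbove_finrank_range f) p

theorem eventually_finrank_range_eq_maxRank (f : ι → V →ₗ[k] W) :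
    ∀ᶠ p in generic k ι, finrank k (LinearMap.range (∑ j, p j • f j)) = maxRank f := by
  obtain ⟨p₀, hp₀⟩ := Nat.sSup_mem (Set.range_nonempty _) (bddAbove_finrank_range f)
  filter_upwards [eventually_finrank_range_le f p₀] with p hp
  exact le_antisymm (finrank_range_le_maxRank f p) (hp₀.symm.trans_le hp)

end Semicontinuity

section Pencil

open Module

variable {k V W : Type*} [Field k] [AddCommGroup V] [Module k V] [AddCommGroup W] [Module k W]

theorem finrank_map_add_finrank_inf_ker (f : V →ₗ[k] W) (P : Submodule k V)
    [FiniteDimensional k P] :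
    finrank k (P.map f) + finrank k (P ⊓ LinearMap.ker f : Submodule k V) = finrank k P := by
  rw [← LinearMap.finrank_range_add_finrank_ker (f.domRestrict P), LinearMap.range_domRestrict,
    LinearMap.ker_domRestrict, ← Submodule.finrank_map_subtype_eq P, Submodule.map_comap_subtype]

theorem finrank_range_mkQ_comp_add (f : V →ₗ[k] W) (Y : Submodule k W) [FiniteDimensional k V] :
    finrank k (LinearMap.range (Y.mkQ ∘ₗ f)) + finrank k (LinearMap.range f ⊓ Y : Submodule k W) =
      finrank k (LinearMap.range f) := by
  rw [LinearMap.range_comp, ← finrank_map_add_finrank_inf_ker Y.mkQ (LinearMap.range f),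
    Submodule.ker_mkQ]

variable [FiniteDimensional k V] {f g : V →ₗ[k] W}

/- Passing to the quotient by `y` keeps the rank of `f` and of a general member of the pencil, but
drops the rank of every member whose range contains `y`. -/
theorem eventually_notMem_range
    (hmax : ∀ a b : k, finrank k (LinearMap.range (a • f + b • g)) ≤ finrank k (LinearMap.range f))
    {y : W} (hy : y ∉ LinearMap.range f) :
    ∀ᶠ p in generic k (Fin 2), y ∉ LinearMap.range (p 0 • f + p 1 • g) := by
  have hy₀ : y ≠ 0 := by
    rintro rfl
    exact hy (zero_mem _)
  have hdisj : LinearMap.range f ⊓ (k ∙ y) = ⊥ := by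
    rw [← disjoint_iff]
    exact (Submodule.disjoint_span_singleton' hy₀).2 hy
  have hrank := finrank_range_mkQ_comp_add f (k ∙ y)
  rw [hdisj, finrank_bot, add_zero] at hrank
  let F : Fin 2 → V →ₗ[k] W ⧸ k ∙ y := ![(k ∙ y).mkQ ∘ₗ f, (k ∙ y).mkQ ∘ₗ g]
  have hsum (p : Fin 2 → k) : ∑ j, p j • F j = (k ∙ y).mkQ ∘ₗ (p 0 • f + p 1 • g) := by
    simp [F, LinearMap.comp_add, LinearMap.comp_smul]
  have hf : (![1, 0] : Fin 2 → k) 0 • f + (![1, 0] : Fin 2 → k) 1 • g = f := by simp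
  filter_upwards [eventually_finrank_range_le F ![1, 0]] with p hp hyp
  rw [hsum, hsum, hf, hrank] at hp
  have hdrop := finrank_range_mkQ_comp_add (p 0 • f + p 1 • g) (k ∙ y)
  rw [inf_eq_right.2 ((Submodule.span_singleton_le_iff_mem _ _).2 hyp),
    finrank_span_singleton hy₀] at hdrop
  have := hmax (p 0) (p 1)
  omega

theorem map_ker_le_range [Infinite k]
    (hmax : ∀ a b : k, finrank k (LinearMap.range (a • f + b • g)) ≤
      finrank k (LinearMap.range f)) :
    (LinearMap.ker f).map g ≤ LinearMap.range f := by
  rintro _ ⟨v, hv : f v = 0, rfl⟩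
  by_contra hgv
  obtain ⟨p, hp, hp₁⟩ := ((eventually_notMem_range hmax hgv).and
    (eventually_generic_apply_ne_zero 1)).exists
  exact hp ⟨(p 1)⁻¹ • v, by simp [hv, smul_smul, hp₁]⟩

theorem comap_map_ker_le_comap_range [Infinite k]
    (hmax : ∀ a b : k, finrank k (LinearMap.range (a • f + b • g)) ≤
      finrank k (LinearMap.range f)) :
    ((LinearMap.ker f).map g).comap f ≤ (LinearMap.range f).comap g := by
  rintro u ⟨v, hv : f v = 0, hvu : g v = f u⟩
  by_contra hgu
  obtain ⟨p, hp, hp₁⟩ := ((eventually_notMem_range hmax hgu).and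
    (eventually_generic_apply_ne_zero 1)).exists
  -- `(a f + b g) (b u - a v) = b² g u`, as the terms `a b f u` and `a b g v` cancel
  refine hp ⟨((p 1) ^ 2)⁻¹ • (p 1 • u - p 0 • v), ?_⟩
  have hcancel : (p 0 • f + p 1 • g) (p 1 • u - p 0 • v) = p 1 ^ 2 • g u := by
    simp only [LinearMap.add_apply, LinearMap.smul_apply, map_sub, map_smul, hv, hvu]
    module
  rw [map_smul, hcancel, inv_smul_smul₀ (pow_ne_zero 2 hp₁)]

theorem finrank_map_ker_add_finrank_range_mkQ_comp_le [Infinite k]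
    (hmax : ∀ a b : k, finrank k (LinearMap.range (a • f + b • g)) ≤
      finrank k (LinearMap.range f)) :
    finrank k ((LinearMap.ker f).map g) +
      finrank k (LinearMap.range ((LinearMap.range f).mkQ ∘ₗ g)) ≤
        finrank k (LinearMap.range f) := by
  set P := ((LinearMap.ker f).map g).comap f with hP
  have hPker : P ≤ LinearMap.ker ((LinearMap.range f).mkQ ∘ₗ g) := by
    rw [LinearMap.ker_comp, Submodule.ker_mkQ]
    exact comap_map_ker_le_comap_range hmax
  have hPfinrank := finrank_map_add_finrank_inf_ker f P
  rw [hP, Submodule.map_comap_eq_of_le (map_ker_le_range hmax),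
    inf_eq_right.2 (LinearMap.ker_le_comap f), ← hP] at hPfinrank
  have := Submodule.finrank_mono hPker
  have := f.finrank_range_add_finrank_ker
  have := ((LinearMap.range f).mkQ ∘ₗ g).finrank_range_add_finrank_ker
  omega

end Pencil

section LinearSystem

open Module

variable {k ι V W : Type*} [Field k] [Fintype ι] [AddCommGroup V] [Module k V]
  [AddCommGroup W] [Module k W]

theorem finrank_le_finrank_inf_iInf_ker_add_sum (K : Submodule k V) [FiniteDimensional k K]
    (f : ι → V →ₗ[k] W) :
    finrank k K ≤ finrank k (K ⊓ ⨅ j, LinearMap.ker (f j) : Submodule k V) +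
      ∑ j, finrank k (K.map (f j)) := by
  let T : K →ₗ[k] ∀ j, K.map (f j) := LinearMap.pi fun j => (f j).submoduleMap K
  have hker : (LinearMap.ker T).map K.subtype = K ⊓ ⨅ j, LinearMap.ker (f j) := by
    rw [← Submodule.map_comap_subtype]
    congr 1
    ext v
    simp [T, LinearMap.ker_pi, Subtype.ext_iff]
  have hrange : finrank k (LinearMap.range T) ≤ ∑ j, finrank k (K.map (f j)) := by
    rw [← finrank_pi_fintype]
    exact T.range.finrank_le
  rw [← hker, Submodule.finrank_map_subtype_eq, ← T.finrank_range_add_finrank_ker, add_comm]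
  gcongr

theorem finrank_iSup_le_sum (Y : ι → Submodule k W) [∀ j, FiniteDimensional k (Y j)] :
    finrank k (⨆ j, Y j : Submodule k W) ≤ ∑ j, finrank k (Y j) := by
  classical
  rw [Submodule.iSup_eq_range_dfinsupp_lsum, ← finrank_directSum]
  exact LinearMap.finrank_range_le _

theorem mem_of_sum_smul_mem {M : Type*} [AddCommGroup M] [Module k M] {Y : Submodule k M}
    {p : ι → k} {x : ι → M} {i : ι} (hi : p i ≠ 0) (hsum : ∑ j, p j • x j ∈ Y)
    (hx : ∀ j ≠ i, x j ∈ Y) : x i ∈ Y := by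
  classical
  rw [← Finset.add_sum_erase _ _ (Finset.mem_univ i), Submodule.add_mem_iff_left _
    (Y.sum_mem fun j hj => Y.smul_mem _ (hx j (Finset.ne_of_mem_erase hj)))] at hsum
  exact (Y.smul_mem_iff hi).1 hsum

theorem ker_sum_smul_inf_iInf_ker_le (f : ι → V →ₗ[k] W) {p : ι → k} {i : ι} (hi : p i ≠ 0) :
    LinearMap.ker (∑ j, p j • f j) ⊓ ⨅ j : {j // j ≠ i}, LinearMap.ker (f j) ≤
      ⨅ j, LinearMap.ker (f j) := by
  rintro v ⟨hsum, hv⟩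
  simp only [SetLike.mem_coe, Submodule.mem_iInf, LinearMap.mem_ker, Subtype.forall,
    LinearMap.sum_apply, LinearMap.smul_apply] at hsum hv ⊢
  have hfi : f i v = 0 := (Submodule.mem_bot k).1 <|
    mem_of_sum_smul_mem (x := fun j => f j v) hi ((Submodule.mem_bot k).2 hsum) hv
  exact fun j => (eq_or_ne j i).elim (fun h => h ▸ hfi) (hv j)

theorem iSup_range_le_range_sum_smul_sup (f : ι → V →ₗ[k] W) {p : ι → k} {i : ι} (hi : p i ≠ 0) :
    ⨆ j, LinearMap.range (f j) ≤
      LinearMap.range (∑ j, p j • f j) ⊔ ⨆ j : {j // j ≠ i}, LinearMap.range (f j) := by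
  set Y := LinearMap.range (∑ j, p j • f j) ⊔ ⨆ j : {j // j ≠ i}, LinearMap.range (f j)
  have hle (j) (hj : j ≠ i) : LinearMap.range (f j) ≤ Y :=
    (le_iSup (fun j : {j // j ≠ i} => LinearMap.range (f j)) ⟨j, hj⟩).trans le_sup_right
  have hfi : LinearMap.range (f i) ≤ Y := by
    rintro _ ⟨v, rfl⟩
    refine mem_of_sum_smul_mem (x := fun j => f j v) hi (Submodule.mem_sup_left ⟨v, ?_⟩)
      fun j hj => hle j hj ⟨v, rfl⟩
    simp only [LinearMap.sum_apply, LinearMap.smul_apply]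
  exact iSup_le fun j => (eq_or_ne j i).elim (fun h => h ▸ hfi) (hle j)

variable [FiniteDimensional k V]

theorem finrank_sup_iSup_range_le (Y : Submodule k W) [FiniteDimensional k Y]
    (f : ι → V →ₗ[k] W) :
    finrank k (Y ⊔ ⨆ j, LinearMap.range (f j) : Submodule k W) ≤
      finrank k Y + ∑ j, finrank k (LinearMap.range (Y.mkQ ∘ₗ f j)) := by
  have hmap : (Y ⊔ ⨆ j, LinearMap.range (f j)).map Y.mkQ =
      ⨆ j, LinearMap.range (Y.mkQ ∘ₗ f j) := by
    simp only [Submodule.map_sup, Submodule.map_iSup, Submodule.mkQ_map_self, bot_sup_eq,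
      LinearMap.range_comp]
  rw [← finrank_map_add_finrank_inf_ker Y.mkQ, hmap, Submodule.ker_mkQ,
    inf_eq_right.2 le_sup_left, add_comm]
  gcongr
  exact finrank_iSup_le_sum _

theorem finrank_add_finrank_sup_iSup_range_le [Infinite k] {g : V →ₗ[k] W} {f : ι → V →ₗ[k] W}
    (hmax : ∀ j, ∀ a b : k, finrank k (LinearMap.range (a • g + b • f j)) ≤
      finrank k (LinearMap.range g)) :
    finrank k V + finrank k (LinearMap.range g ⊔ ⨆ j, LinearMap.range (f j) : Submodule k W) ≤
      (Fintype.card ι + 2) * finrank k (LinearMap.range g) +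
        finrank k (LinearMap.ker g ⊓ ⨅ j, LinearMap.ker (f j) : Submodule k V) := by
  have hpencil : ∑ j, (finrank k ((LinearMap.ker g).map (f j)) +
      finrank k (LinearMap.range ((LinearMap.range g).mkQ ∘ₗ f j))) ≤
        Fintype.card ι * finrank k (LinearMap.range g) :=
    Finset.sum_le_card_nsmul _ _ _ fun j _ =>
      finrank_map_ker_add_finrank_range_mkQ_comp_le (hmax j)
  have := finrank_le_finrank_inf_iInf_ker_add_sum (LinearMap.ker g) f
  have := finrank_sup_iSup_range_le (LinearMap.range g) f
  have := g.finrank_range_add_finrank_ker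
  rw [Finset.sum_add_distrib] at hpencil
  linarith

theorem finrank_add_finrank_iSup_range_le [Infinite k] (f : ι → V →ₗ[k] W) :
    finrank k V + finrank k (⨆ j, LinearMap.range (f j) : Submodule k W) ≤
      (Fintype.card ι + 1) * maxRank f +
        finrank k (⨅ j, LinearMap.ker (f j) : Submodule k V) := by
  classical
  obtain hι | ⟨⟨i⟩⟩ := isEmpty_or_nonempty ι
  · rw [iSup_of_empty, iInf_of_empty, finrank_bot, finrank_top]
    omega
  obtain ⟨p, hp, hpi⟩ := ((eventually_finrank_range_eq_maxRank f).and
    (eventually_generic_apply_ne_zero i)).exists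
  set g := ∑ j, p j • f j with hg
  have hmax (j : {j // j ≠ i}) (a b : k) :
      finrank k (LinearMap.range (a • g + b • f j)) ≤ finrank k (LinearMap.range g) := by
    have hcomb : a • g + b • f j = ∑ l, (a • p + b • Pi.single j.1 1 : ι → k) l • f l := by
      simp [hg, add_smul, Finset.sum_add_distrib, Finset.smul_sum, smul_smul, Pi.single_apply]
    rw [hcomb, hp]
    exact finrank_range_le_maxRank f _
  have hsystem := finrank_add_finrank_sup_iSup_range_le hmax
  have hcard : Fintype.card {j // j ≠ i} + 2 = Fintype.card ι + 1 := by
    have := Fintype.card_pos_iff.2 ⟨i⟩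
    rw [Fintype.card_subtype_compl, Fintype.card_subtype_eq]
    omega
  rw [hcard, hp] at hsystem
  have hker := Submodule.finrank_mono (ker_sum_smul_inf_iInf_ker_le f hpi)
  have hrange := Submodule.finrank_mono (iSup_range_le_range_sum_smul_sup f hpi)
  rw [← hg] at hker hrange
  omega

end LinearSystem

section Action

variable {k : Type*} [Field k] {r : ℕ} {w : ActionKind}

theorem ActionKind.weight_eq_zero_of_not_le {a b : Fin r →₀ ℕ} (h : ¬a ≤ b) :
    w.weight k a b = 0 := by
  obtain ⟨i, hi⟩ : ∃ i, b i < a i := by simpa [Finsupp.le_def] using h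
  refine match w with
    | .differentiation => Finset.prod_eq_zero (Finset.mem_univ i) ?_
    | .contraction => Finset.prod_eq_zero (Finset.mem_univ i) (if_neg hi.not_ge)
  rw [Nat.descFactorial_eq_zero_iff_lt.2 hi, Nat.cast_zero]

/-- The characteristic is `0` or exceeds `e` if the action is by differentiation, which is what
makes the action nondegenerate in degrees at most `e`. -/
def ActionKind.Admissible (k : Type*) [Field k] (w : ActionKind) (e : ℕ) : Prop :=
  w = .differentiation → ringChar k = 0 ∨ e < ringChar k

theorem ActionKind.Admissible.weight_ne_zero {e : ℕ} (hw : w.Admissible k e)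
    {a b : Fin r →₀ ℕ} (hab : a ≤ b) (hb : b.degree ≤ e) : w.weight k a b ≠ 0 := by
  cases w
  · refine Finset.prod_ne_zero_iff.2 fun i _ => ?_
    rw [Ne, ringChar.spec]
    intro hdvd
    have hpos : (b i).descFactorial (a i) ≠ 0 :=
      mt Nat.descFactorial_eq_zero_iff_lt.1 (hab i).not_gt
    obtain hchar | hchar := hw rfl
    · exact hpos (zero_dvd_iff.1 (hchar ▸ hdvd))
    · have hprime : (ringChar k).Prime :=
        (CharP.char_is_prime_or_zero k (ringChar k)).resolve_right (by omega)
      have hdvd' : ringChar k ∣ (b i).factorial :=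
        Nat.factorial_mul_descFactorial (hab i) ▸ hdvd.mul_left _
      exact (hchar.trans_le (hprime.dvd_factorial.1 hdvd')).not_ge
        ((Finsupp.le_degree i b).trans hb)
  · exact Finset.prod_ne_zero_iff.2 fun i _ => by simp [hab i]

theorem coeff_act_monomial (w : ActionKind) (a c : Fin r →₀ ℕ) (G : MvPolynomial (Fin r) k) :
    coeff c (act w (monomial a 1) G) = w.weight k a (c + a) * coeff (c + a) G := by
  classical
  suffices h : lcoeff k c ∘ₗ act w (monomial a 1) = w.weight k a (c + a) • lcoeff k (c + a) from
    LinearMap.congr_fun h G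
  refine (basisMonomials (Fin r) k).ext fun b => ?_
  simp only [coe_basisMonomials, LinearMap.comp_apply, LinearMap.smul_apply, act_monomial,
    lcoeff_apply, coeff_monomial, smul_eq_mul, mul_ite, mul_one, mul_zero]
  by_cases hab : a ≤ b
  · simp only [tsub_eq_iff_eq_add_of_le hab]
    split_ifs with hb
    · rw [hb]
    · rfl
  · have hb : b ≠ c + a := fun hb => hab (hb ▸ le_add_self)
    rw [ActionKind.weight_eq_zero_of_not_le hab, ite_self, if_neg hb]

theorem coeff_act (w : ActionKind) (φ G : MvPolynomial (Fin r) k) (c : Fin r →₀ ℕ) :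
    coeff c (act w φ G) =
      ∑ a ∈ φ.support, coeff a φ * (w.weight k a (c + a) * coeff (c + a) G) := by
  conv_lhs => rw [φ.as_sum]
  rw [map_sum, LinearMap.sum_apply, coeff_sum]
  refine Finset.sum_congr rfl fun a _ => ?_
  rw [← coeff_act_monomial, ← smul_eq_mul, ← coeff_smul, ← LinearMap.smul_apply, ← map_smul,
    smul_monomial, smul_eq_mul, mul_one]

theorem exists_coeff_ne_zero_of_coeff_act_ne_zero {φ G : MvPolynomial (Fin r) k}
    {c : Fin r →₀ ℕ} (h : coeff c (act w φ G) ≠ 0) :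
    ∃ a, coeff a φ ≠ 0 ∧ coeff (c + a) G ≠ 0 := by
  rw [coeff_act] at h
  obtain ⟨a, -, ha⟩ := Finset.exists_ne_zero_of_sum_ne_zero h
  exact ⟨a, left_ne_zero_of_mul ha, right_ne_zero_of_mul (right_ne_zero_of_mul ha)⟩

theorem totalDegree_act_le (w : ActionKind) (φ G : MvPolynomial (Fin r) k) :
    (act w φ G).totalDegree ≤ G.totalDegree := by
  refine Finset.sup_le fun c hc => ?_
  obtain ⟨a, -, hca⟩ := exists_coeff_ne_zero_of_coeff_act_ne_zero (mem_support_iff.1 hc)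
  exact (Finsupp.degree_mono le_self_add : c.degree ≤ (c + a).degree).trans
    (le_totalDegree (mem_support_iff.2 hca))

section Homogeneous

variable {φ G : MvPolynomial (Fin r) k} {i d : ℕ}

theorem degree_add_eq_of_coeff_act_ne_zero (hφ : φ.IsHomogeneous i) (hG : G.IsHomogeneous d)
    {c : Fin r →₀ ℕ} (hc : coeff c (act w φ G) ≠ 0) : c.degree + i = d := by
  obtain ⟨a, ha, hca⟩ := exists_coeff_ne_zero_of_coeff_act_ne_zero hc
  rw [← not_imp_comm.1 hφ.coeff_eq_zero ha, ← not_imp_comm.1 hG.coeff_eq_zero hca, map_add]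

theorem isHomogeneous_act (w : ActionKind) (hφ : φ.IsHomogeneous i) (hG : G.IsHomogeneous d) :
    (act w φ G).IsHomogeneous (d - i) := by
  intro c hc
  rw [← degree_add_eq_of_coeff_act_ne_zero hφ hG hc, Nat.add_sub_cancel,
    Finsupp.degree_eq_weight_one]
  rfl

theorem act_eq_zero_of_lt (w : ActionKind) (hφ : φ.IsHomogeneous i) (hG : G.IsHomogeneous d)
    (h : d < i) : act w φ G = 0 := by
  ext c
  by_contra hc
  have := degree_add_eq_of_coeff_act_ne_zero hφ hG hc
  omega

theorem homogeneousComponent_act (w : ActionKind) (φ : MvPolynomial (Fin r) k)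
    (hG : G.IsHomogeneous d) (hi : i ≤ d) :
    homogeneousComponent (d - i) (act w φ G) = act w (homogeneousComponent i φ) G := by
  induction φ using MvPolynomial.induction_on' with
  | add φ ψ hφ hψ => simp only [map_add, LinearMap.add_apply, hφ, hψ]
  | monomial a c =>
    have ha : (monomial a c).IsHomogeneous a.degree := isHomogeneous_monomial c rfl
    have hact := isHomogeneous_act w ha hG
    rw [homogeneousComponent_of_mem ((mem_homogeneousSubmodule _ _).2 ha)]
    obtain rfl | hia := eq_or_ne i a.degree
    · rw [homogeneousComponent_of_mem ((mem_homogeneousSubmodule _ _).2 hact), if_pos rfl,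
        if_pos rfl]
    rw [if_neg hia, map_zero, LinearMap.zero_apply]
    obtain had | had := lt_or_ge d a.degree
    · rw [act_eq_zero_of_lt w ha hG had, map_zero]
    · rw [homogeneousComponent_of_mem ((mem_homogeneousSubmodule _ _).2 hact),
        if_neg (by omega)]

end Homogeneous

end Action

section Pairing

open Module

variable {k : Type*} [Field k] {r e : ℕ} {w : ActionKind}

/-- The `k`-bilinear pairing `R × S → k` sending `(φ, G)` to the constant term of `φ ∘ G`. In each
degree it is the perfect pairing behind Macaulay duality. -/
noncomputable def pairing (w : ActionKind) :
    MvPolynomial (Fin r) k →ₗ[k] MvPolynomial (Fin r) k →ₗ[k] k :=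
  (act w).compr₂ (lcoeff k 0)

theorem pairing_mul (φ ψ G : MvPolynomial (Fin r) k) :
    pairing w (φ * ψ) G = pairing w φ (act w ψ G) := by
  simp only [pairing, LinearMap.compr₂_apply, act_mul]

theorem pairing_eq_zero_of_act_eq_zero {φ G : MvPolynomial (Fin r) k} (h : act w φ G = 0) :
    pairing w φ G = 0 := by
  rw [pairing, LinearMap.compr₂_apply, h, map_zero]

theorem pairing_monomial (b : Fin r →₀ ℕ) (G : MvPolynomial (Fin r) k) :
    pairing w (monomial b 1) G = w.weight k b b * coeff b G := by
  rw [pairing, LinearMap.compr₂_apply, lcoeff_apply, coeff_act_monomial, zero_add]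

theorem eq_zero_of_pairing_monomial_eq_zero (hw : w.Admissible k e)
    {G : MvPolynomial (Fin r) k} {d : ℕ} (hG : G.IsHomogeneous d) (hd : d ≤ e)
    (h : ∀ b : Fin r →₀ ℕ, b.degree = d → pairing w (monomial b 1) G = 0) : G = 0 := by
  ext b
  by_cases hb : b.degree = d
  · have hbG := h b hb
    rw [pairing_monomial] at hbG
    exact (mul_eq_zero.1 hbG).resolve_left (hw.weight_ne_zero le_rfl (hb.trans_le hd))
  · exact hG.coeff_eq_zero hb

theorem eq_zero_of_act_X (hw : w.Admissible k e) {G : MvPolynomial (Fin r) k} {d : ℕ}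
    (hG : G.IsHomogeneous d) (hd : d ≤ e) (hd₀ : d ≠ 0) (h : ∀ j, act w (X j) G = 0) : G = 0 := by
  refine eq_zero_of_pairing_monomial_eq_zero hw hG hd fun b hb => ?_
  obtain ⟨j, hj⟩ : ∃ j, b j ≠ 0 := by
    by_contra! hb₀
    exact hd₀ (by rw [← hb, Finsupp.degree_eq_zero_iff]; exact Finsupp.ext hb₀)
  have hbj : Finsupp.single j 1 ≤ b := Finsupp.single_le_iff.2 (Nat.one_le_iff_ne_zero.2 hj)
  have hX : monomial b (1 : k) = monomial (b - Finsupp.single j 1) 1 * X j := by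
    rw [X, monomial_mul, tsub_add_cancel_of_le hbj, mul_one]
  rw [hX, pairing_mul, h j, map_zero]

instance finite_homogeneousSubmodule (u : ℕ) :
    Module.Finite k (homogeneousSubmodule (Fin r) k u) :=
  Module.Finite.iff_fg.2 (homogeneousSubmodule_fg (Fin r) k u)

theorem exists_isHomogeneous_pairing_eq (hw : w.Admissible k e)
    (l : MvPolynomial (Fin r) k →ₗ[k] k) :
    ∃ G : MvPolynomial (Fin r) k, G.IsHomogeneous e ∧
      ∀ φ : MvPolynomial (Fin r) k, φ.IsHomogeneous e → pairing w φ G = l φ := by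
  let T : homogeneousSubmodule (Fin r) k e →ₗ[k] Dual k (homogeneousSubmodule (Fin r) k e) :=
    (pairing w).flip.domRestrict₁₂ _ _
  have T_injective : Function.Injective T := (injective_iff_map_eq_zero T).2 fun G hG =>
    Subtype.ext <| eq_zero_of_pairing_monomial_eq_zero hw G.2 le_rfl fun b hb =>
      LinearMap.congr_fun hG ⟨monomial b 1, isHomogeneous_monomial 1 hb⟩
  obtain ⟨G, hG⟩ := (LinearMap.injective_iff_surjective_of_finrank_eq_finrank
    Subspace.dual_finrank_eq.symm).1 T_injective (l.domRestrict _)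
  exact ⟨G, G.2, fun φ hφ => LinearMap.congr_fun hG ⟨φ, hφ⟩⟩

end Pairing

section Catalecticant

attribute [local instance] MvPolynomial.gradedAlgebra

open Module

variable {k : Type*} [Field k] {r e t : ℕ} {w : ActionKind} {I : Ideal (MvPolynomial (Fin r) k)}

instance finite_gradedPiece (I : Ideal (MvPolynomial (Fin r) k)) (u : ℕ) :
    Module.Finite k (gradedPiece I u) :=
  inferInstanceAs (Module.Finite k (Submodule.map _ _))

theorem mk_mem_socle {φ : MvPolynomial (Fin r) k} :
    Ideal.Quotient.mk I φ ∈ socle I ↔ ∀ j, X j * φ ∈ I := by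
  refine ⟨fun h j => ?_, fun h m hm => ?_⟩
  · rw [← Ideal.Quotient.eq_zero_iff_mem, mul_comm, map_mul]
    exact h _ (Ideal.subset_span ⟨j, rfl⟩)
  · induction hm using Submodule.span_induction with
    | mem _ hx =>
      obtain ⟨j, rfl⟩ := hx
      rw [← map_mul, mul_comm, Ideal.Quotient.eq_zero_iff_mem]
      exact h j
    | zero => rw [mul_zero]
    | add _ _ _ _ hx hy => rw [mul_add, hx, hy, add_zero]
    | smul _ _ _ hx => rw [smul_eq_mul, mul_left_comm, hx, mul_zero]

/-- The degree `u` component `I_u` of a homogeneous ideal `I`, as a subspace of `R_u`. -/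
noncomputable def homogeneousPart (I : Ideal (MvPolynomial (Fin r) k)) (u : ℕ) :
    Submodule k (homogeneousSubmodule (Fin r) k u) :=
  (I.restrictScalars k).comap (homogeneousSubmodule (Fin r) k u).subtype

theorem hVector_add_finrank_homogeneousPart (I : Ideal (MvPolynomial (Fin r) k)) (u : ℕ) :
    hVector I u + finrank k (homogeneousPart I u) =
      finrank k (homogeneousSubmodule (Fin r) k u) := by
  set f := (Ideal.Quotient.mkₐ k I).toLinearMap.domRestrict (homogeneousSubmodule (Fin r) k u)
  have hker : LinearMap.ker f = homogeneousPart I u :=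
    Submodule.ext fun _ => Ideal.Quotient.eq_zero_iff_mem
  rw [hVector, gradedPiece, ← LinearMap.range_domRestrict, ← hker, f.finrank_range_add_finrank_ker]

/-- The catalecticant map `R_u → S`, `φ ↦ φ ∘ G`, as a linear function of `G`. -/
noncomputable def catalecticant (w : ActionKind) (u : ℕ) :
    MvPolynomial (Fin r) k →ₗ[k] homogeneousSubmodule (Fin r) k u →ₗ[k] MvPolynomial (Fin r) k :=
  ((act w).domRestrict (homogeneousSubmodule (Fin r) k u)).flip

theorem ker_catalecticant (w : ActionKind) (u : ℕ) (G : MvPolynomial (Fin r) k) :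
    LinearMap.ker (catalecticant w u G) = homogeneousPart (ann w G) u :=
  rfl

theorem hVector_ann (w : ActionKind) (G : MvPolynomial (Fin r) k) (u : ℕ) :
    hVector (ann w G) u = finrank k (LinearMap.range (catalecticant w u G)) := by
  have hrank := (catalecticant w u G).finrank_range_add_finrank_ker
  rw [ker_catalecticant, ← hVector_add_finrank_homogeneousPart (ann w G) u] at hrank
  exact (Nat.add_right_cancel hrank).symm

section Gorenstein

variable {G : MvPolynomial (Fin r) k}

theorem hVector_ann_eq_zero (hG : G.IsHomogeneous e) {u : ℕ} (hu : e < u) :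
    hVector (ann w G) u = 0 := by
  have hzero : catalecticant w u G = 0 := LinearMap.ext fun φ => act_eq_zero_of_lt w φ.2 hG hu
  rw [hVector_ann, hzero, LinearMap.range_zero, finrank_bot]

theorem hVector_ann_self (hw : w.Admissible k e) (hG : G.IsHomogeneous e) (hG₀ : G ≠ 0) :
    hVector (ann w G) e = 1 := by
  rw [hVector_ann]
  refine le_antisymm ?_ (Nat.one_le_iff_ne_zero.2 fun h => hG₀ ?_)
  · have hle : LinearMap.range (catalecticant w e G) ≤ k ∙ (1 : MvPolynomial (Fin r) k) := by
      rintro _ ⟨φ, rfl⟩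
      have hφG : (act w φ.1 G).IsHomogeneous 0 := Nat.sub_self e ▸ isHomogeneous_act w φ.2 hG
      rw [← totalDegree_zero_iff_isHomogeneous, totalDegree_eq_zero_iff_eq_C] at hφG
      refine Submodule.mem_span_singleton.2 ⟨coeff 0 (act w φ.1 G), ?_⟩
      rw [smul_eq_C_mul, mul_one, ← hφG]
      rfl
    simpa only [finrank_span_singleton one_ne_zero] using Submodule.finrank_mono hle
  · rw [Submodule.finrank_eq_zero, LinearMap.range_eq_bot] at h
    exact eq_zero_of_pairing_monomial_eq_zero hw hG le_rfl fun b hb =>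
      pairing_eq_zero_of_act_eq_zero (LinearMap.congr_fun h ⟨_, isHomogeneous_monomial 1 hb⟩)

theorem isHomogeneous_ann (hG : G.IsHomogeneous e) :
    (ann w G).IsHomogeneous (homogeneousSubmodule (Fin r) k) := by
  intro i φ (hφ : act w φ G = 0)
  have hφi : act w (homogeneousComponent i φ) G = 0 := by
    obtain hi | hi := lt_or_ge e i
    · exact act_eq_zero_of_lt w (homogeneousComponent_isHomogeneous i φ) hG hi
    · rw [← homogeneousComponent_act w φ hG hi, hφ, map_zero]
  rwa [← decomposition.decompose'_apply] at hφi

theorem finite_quotient_ann (w : ActionKind) (G : MvPolynomial (Fin r) k) :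
    Module.Finite k (MvPolynomial (Fin r) k ⧸ ann w G) := by
  have hrange : LinearMap.range ((act w).flip G) ≤
      restrictTotalDegree (Fin r) k G.totalDegree := by
    rintro _ ⟨φ, rfl⟩
    exact (mem_restrictTotalDegree _ _ _).2 (totalDegree_act_le w φ G)
  have := Submodule.finiteDimensional_of_le hrange
  exact Module.Finite.equiv (((act w).flip G).quotKerEquivRange.symm.trans
    (Submodule.Quotient.restrictScalarsEquiv k (ann w G)))

theorem isGorenstein_ann (hw : w.Admissible k e) (hG : G.IsHomogeneous e) (hG₀ : G ≠ 0) :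
    IsGorenstein (ann w G) e where
  homogeneous := isHomogeneous_ann hG
  artinian := by
    have := finite_quotient_ann w G
    exact IsArtinianRing.of_finite k _
  hVector_pos := by rw [hVector_ann_self hw hG hG₀]; exact one_pos
  hVector_eq_zero i hi := hVector_ann_eq_zero hG hi
  socleVector_eq i := by
    split_ifs with hi
    · subst hi
      have hle : gradedPiece (ann w G) i ≤ socle (ann w G) := by
        rintro _ ⟨φ, hφ, rfl⟩
        exact mk_mem_socle.2 fun j =>
          act_eq_zero_of_lt w ((isHomogeneous_X k j).mul hφ) hG (by omega)
      rw [socleVector, inf_eq_right.2 hle]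
      exact hVector_ann_self hw hG hG₀
    · rw [socleVector, Submodule.finrank_eq_zero, eq_bot_iff]
      rintro _ ⟨hsocle, φ, hφ, rfl⟩
      refine Ideal.Quotient.eq_zero_iff_mem.2 (?_ : act w φ G = 0)
      obtain hei | hie := lt_or_ge e i
      · exact act_eq_zero_of_lt w hφ hG hei
      · refine eq_zero_of_act_X hw (isHomogeneous_act w hφ hG) (Nat.sub_le e i) (by omega)
          fun j => ?_
        rw [← act_mul]
        exact mk_mem_socle.1 hsocle j

end Gorenstein

section Duality

theorem mem_inverseSystemPart_of_pairing_eq_zero (hw : w.Admissible k e)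
    (hI : I.IsHomogeneous (homogeneousSubmodule (Fin r) k)) {G : MvPolynomial (Fin r) k}
    (hG : G.IsHomogeneous e)
    (h : ∀ φ ∈ I, φ.IsHomogeneous e → pairing w φ G = 0) : G ∈ inverseSystemPart w I e := by
  refine ⟨fun ψ hψ => ?_, hG⟩
  rw [← sum_homogeneousComponent ψ, map_sum, LinearMap.sum_apply]
  refine Finset.sum_eq_zero fun i _ => ?_
  have hψi := homogeneousComponent_isHomogeneous i ψ
  obtain hi | hi := lt_or_ge e i
  · exact act_eq_zero_of_lt w hψi hG hi
  refine eq_zero_of_pairing_monomial_eq_zero hw (isHomogeneous_act w hψi hG) (Nat.sub_le e i)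
    fun b hb => ?_
  rw [← pairing_mul]
  refine h _ (I.mul_mem_left _ (homogeneousComponent_mem_of_mem hI hψ i)) ?_
  exact Nat.sub_add_cancel hi ▸ (isHomogeneous_monomial 1 hb).mul hψi

theorem mem_of_forall_act_eq_zero_top (hw : w.Admissible k e)
    (hI : I.IsHomogeneous (homogeneousSubmodule (Fin r) k)) {φ : MvPolynomial (Fin r) k}
    (hφ : φ.IsHomogeneous e) (h : ∀ G ∈ inverseSystemPart w I e, act w φ G = 0) : φ ∈ I := by
  by_contra hφI
  obtain ⟨l, hlφ, hl⟩ := Submodule.exists_le_ker_of_notMem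
    (fun hφ' => hφI hφ'.2 : φ ∉ homogeneousSubmodule (Fin r) k e ⊓ I.restrictScalars k)
  obtain ⟨G, hG, hGl⟩ := exists_isHomogeneous_pairing_eq (r := r) hw l
  have hGI : G ∈ inverseSystemPart w I e :=
    mem_inverseSystemPart_of_pairing_eq_zero hw hI hG fun ψ hψI hψ => by
      rw [hGl ψ hψ]
      exact hl ⟨hψ, hψI⟩
  exact hlφ (by rw [← hGl φ hφ, pairing_eq_zero_of_act_eq_zero (h G hGI)])

theorem IsLevel.mem_of_forall_act_eq_zero (hw : w.Admissible k e) (hI : IsLevel I e t) {u : ℕ}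
    (hu : u ≤ e) {φ : MvPolynomial (Fin r) k} (hφ : φ.IsHomogeneous u)
    (h : ∀ G ∈ inverseSystemPart w I e, act w φ G = 0) : φ ∈ I := by
  induction hu using Nat.decreasingInduction generalizing φ with
  | self => exact mem_of_forall_act_eq_zero_top hw hI.homogeneous hφ h
  | of_succ u hu ih =>
    have hX (j : Fin r) : X j * φ ∈ I := by
      refine ih (add_comm u 1 ▸ (isHomogeneous_X k j).mul hφ) fun G hG => ?_
      rw [act_mul, h G hG, map_zero]
    have hsocle := hI.socleVector_eq u
    rw [if_neg hu.ne, socleVector, Submodule.finrank_eq_zero] at hsocle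
    rw [← Ideal.Quotient.eq_zero_iff_mem, ← Submodule.mem_bot k, ← hsocle]
    exact ⟨mk_mem_socle.2 hX, φ, hφ, rfl⟩

theorem IsLevel.iInf_ker_catalecticant (hw : w.Admissible k e) (hI : IsLevel I e t)
    {ι : Type*} (F : Basis ι k (inverseSystemPart w I e)) {u : ℕ} (hu : u ≤ e) :
    ⨅ j, LinearMap.ker (catalecticant w u (F j).1) = homogeneousPart I u := by
  ext φ
  rw [Submodule.mem_iInf]
  refine ⟨fun h => hI.mem_of_forall_act_eq_zero hw hu φ.2 fun G hG => ?_,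
    fun hφ j => (F j).2.1 φ hφ⟩
  have hact : act w φ.1 ∘ₗ (inverseSystemPart w I e).subtype = 0 := F.ext h
  exact LinearMap.congr_fun hact ⟨G, hG⟩

theorem IsLevel.nonempty_index_of_basis (hw : w.Admissible k e) (hI : IsLevel I e t)
    {ι : Type*} (F : Basis ι k (inverseSystemPart w I e)) : Nonempty ι := by
  by_contra hι
  rw [not_nonempty_iff] at hι
  have htop := hI.iInf_ker_catalecticant hw F le_rfl
  rw [iInf_of_empty] at htop
  have hpos := hI.hVector_pos
  have hrank := hVector_add_finrank_homogeneousPart I e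
  rw [← htop, finrank_top] at hrank
  omega

theorem hVector_le_finrank_iSup_range_catalecticant (hw : w.Admissible k e) {ι : Type*} [Finite ι]
    {F : ι → MvPolynomial (Fin r) k} (hF : ∀ j, (F j).IsHomogeneous e) {u v : ℕ} (huv : u + v = e)
    (hI : ⨅ j, LinearMap.ker (catalecticant w v (F j)) ≤ homogeneousPart I v) :
    hVector I v ≤ finrank k
      (⨆ j, LinearMap.range (catalecticant w u (F j)) : Submodule k (MvPolynomial (Fin r) k)) := by
  set Y : Submodule k (MvPolynomial (Fin r) k) := ⨆ j, LinearMap.range (catalecticant w u (F j))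
  let T : homogeneousSubmodule (Fin r) k v →ₗ[k] Dual k Y := (pairing w).domRestrict₁₂ _ Y
  have hker : LinearMap.ker T ≤ homogeneousPart I v := by
    refine le_trans (fun ψ hψ => (Submodule.mem_iInf _).2 fun j => ?_) hI
    have hψF : (act w ψ.1 (F j)).IsHomogeneous u := by
      simpa only [← huv, Nat.add_sub_cancel] using isHomogeneous_act w ψ.2 (hF j)
    refine eq_zero_of_pairing_monomial_eq_zero hw hψF (by omega) fun b hb => ?_
    change pairing w (monomial b 1) (act w ψ.1 (F j)) = 0
    rw [← pairing_mul, mul_comm, pairing_mul]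
    exact LinearMap.congr_fun hψ ⟨_, Submodule.mem_iSup_of_mem j
      ⟨⟨monomial b 1, isHomogeneous_monomial 1 hb⟩, rfl⟩⟩
  have := Submodule.finrank_mono hker
  have := T.finrank_range_add_finrank_ker
  have := hVector_add_finrank_homogeneousPart I v
  have hrange := (LinearMap.range T).finrank_le
  rw [Subspace.dual_finrank_eq] at hrange
  omega

end Duality

end Catalecticant

section Projective

variable {k : Type*} [Field k] {t : ℕ}

theorem eval_smul_of_isHomogeneous {ι : Type*} {g : MvPolynomial ι k} {d : ℕ}
    (hg : g.IsHomogeneous d) (c : k) (v : ι → k) : eval (c • v) g = c ^ d * eval v g := by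
  rw [eval_eq, eval_eq, Finset.mul_sum]
  refine Finset.sum_congr rfl fun a ha => ?_
  have hdeg : ∑ i ∈ a.support, a i = d :=
    not_imp_comm.1 hg.coeff_eq_zero (mem_support_iff.1 ha)
  simp only [Pi.smul_apply, smul_eq_mul, mul_pow, Finset.prod_mul_distrib,
    Finset.prod_pow_eq_pow_sum, hdeg]
  ring

theorem eval_rep_mk_ne_zero_iff {ι : Type*} {g : MvPolynomial ι k} {d : ℕ}
    (hg : g.IsHomogeneous d) {v : ι → k} (hv : v ≠ 0) :
    eval (Projectivization.mk k v hv).rep g ≠ 0 ↔ eval v g ≠ 0 := by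
  obtain ⟨a, ha⟩ := Projectivization.exists_smul_eq_mk_rep k v hv
  rw [← ha, Units.smul_def, eval_smul_of_isHomogeneous hg, mul_ne_zero_iff_left
    (pow_ne_zero d a.ne_zero)]

theorem eventually_generic_ne_zero {ι : Type*} [Nonempty ι] : ∀ᶠ v in generic k ι, v ≠ 0 := by
  inhabit ι
  filter_upwards [eventually_generic_apply_ne_zero default] with v hv
  exact Function.ne_iff.2 ⟨default, hv⟩

theorem IsZariskiOpen.eventually_mk_mem {U : Set (Projectivization k (Fin t → k))}
    (hU : IsZariskiOpen U) (hne : U.Nonempty) :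
    ∀ᶠ v in generic k (Fin t), ∀ hv : v ≠ 0, Projectivization.mk k v hv ∈ U := by
  obtain ⟨T, hT, rfl⟩ := hU
  obtain ⟨p, g, hgT, hgp⟩ := hne
  obtain ⟨d, hg⟩ := hT g hgT
  have hg₀ : g ≠ 0 := by
    rintro rfl
    exact hgp (map_zero _)
  filter_upwards [eventually_generic_eval_ne_zero hg hg₀] with v hgv hv
  exact ⟨g, hgT, (eval_rep_mk_ne_zero_iff hg hv).2 hgv⟩

theorem IsZariskiOpen.inter_nonempty [Infinite k] {U U' : Set (Projectivization k (Fin t → k))}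
    (hU : IsZariskiOpen U) (hU' : IsZariskiOpen U') (hne : U.Nonempty) (hne' : U'.Nonempty) :
    (U ∩ U').Nonempty := by
  obtain ⟨p, -⟩ := id hne
  obtain ⟨i, -⟩ := Function.ne_iff.1 p.rep_nonzero
  have : Nonempty (Fin t) := ⟨i⟩
  obtain ⟨v, hvU, hvU', hv⟩ := ((hU.eventually_mk_mem hne).and
    ((hU'.eventually_mk_mem hne').and eventually_generic_ne_zero)).exists
  exact ⟨_, hvU hv, hvU' hv⟩

theorem exists_isZariskiOpen [Infinite k] [Nonempty (Fin t)] {P : (Fin t → k) → Prop}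
    (hP : ∀ᶠ v in generic k (Fin t), P v) :
    ∃ U : Set (Projectivization k (Fin t → k)), IsZariskiOpen U ∧ U.Nonempty ∧
      ∀ p ∈ U, P p.rep := by
  obtain ⟨D, hD₀, ⟨d, hD⟩, hDP⟩ := eventually_generic_iff.1 hP
  obtain ⟨v, hDv, hv⟩ :=
    ((eventually_generic_eval_ne_zero hD hD₀).and eventually_generic_ne_zero).exists
  refine ⟨{p | eval p.rep D ≠ 0}, ⟨{D}, ?_, ?_⟩, ⟨_, (eval_rep_mk_ne_zero_iff hD hv).2 hDv⟩,
    fun p => hDP p.rep⟩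
  · rintro _ rfl
    exact ⟨d, hD⟩
  · simp only [Set.mem_singleton_iff, exists_eq_left]

theorem IsGenericGorensteinHVector.unique [Infinite k] {r e : ℕ} {w : ActionKind}
    {I : Ideal (MvPolynomial (Fin r) k)} {F : Fin t → MvPolynomial (Fin r) k} {H H' : ℕ → ℕ}
    (h : IsGenericGorensteinHVector w I e F H) (h' : IsGenericGorensteinHVector w I e F H') :
    H = H' := by
  obtain ⟨U, hU, hne, hH⟩ := h
  obtain ⟨U', hU', hne', hH'⟩ := h'
  obtain ⟨p, hp, hp'⟩ := hU.inter_nonempty hU' hne hne'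
  funext u
  rw [← (hH p hp).2.2 u, (hH' p hp').2.2 u]

end Projective

section GenericQuotient

open Module

variable {k : Type*} [Field k] {r e t : ℕ} {w : ActionKind} {I : Ideal (MvPolynomial (Fin r) k)}

section Form

variable {F : Fin t → MvPolynomial (Fin r) k} (p : Projectivization k (Fin t → k))

theorem isHomogeneous_formAt (hF : ∀ j, (F j).IsHomogeneous e) :
    (formAt F p).IsHomogeneous e :=
  IsHomogeneous.sum _ _ _ fun j _ => (homogeneousSubmodule (Fin r) k e).smul_mem _ (hF j)

theorem formAt_ne_zero (hF : LinearIndependent k F) : formAt F p ≠ 0 := fun h =>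
  p.rep_nonzero (funext (Fintype.linearIndependent_iff.1 hF _ h))

theorem le_ann_formAt (hF : ∀ j, F j ∈ inverseSystem w I) : I ≤ ann w (formAt F p) := fun φ hφ =>
  ((inverseSystem w I).sum_mem fun j _ => (inverseSystem w I).smul_mem _ (hF j) :
    formAt F p ∈ inverseSystem w I) φ hφ

end Form

variable {ι : Type*} [Fintype ι]

/-- The sequence of the largest values of the `h`-vectors of the algebras `R / Ann(∑ j, p_j F_j)`,
which a general member of this family attains. -/
noncomputable def genericHVector (w : ActionKind) (F : ι → MvPolynomial (Fin r) k) (u : ℕ) : ℕ :=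
  ⨆ p : ι → k, hVector (ann w (∑ j, p j • F j)) u

theorem hVector_ann_sum_smul (w : ActionKind) (F : ι → MvPolynomial (Fin r) k) (p : ι → k)
    (u : ℕ) : hVector (ann w (∑ j, p j • F j)) u =
      finrank k (LinearMap.range (∑ j, p j • catalecticant w u (F j))) := by
  have hsum : catalecticant w u (∑ j, p j • F j) = ∑ j, p j • catalecticant w u (F j) := by
    rw [map_sum]
    exact Finset.sum_congr rfl fun j _ => map_smul (catalecticant w u) (p j) (F j)
  rw [hVector_ann, hsum]

theorem genericHVector_eq_maxRank (w : ActionKind) (F : ι → MvPolynomial (Fin r) k) (u : ℕ) :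
    genericHVector w F u = maxRank fun j => catalecticant w u (F j) :=
  iSup_congr fun p => hVector_ann_sum_smul w F p u

theorem eventually_hVector_ann_eq_genericHVector (w : ActionKind)
    {F : ι → MvPolynomial (Fin r) k} (hF : ∀ j, (F j).IsHomogeneous e) :
    ∀ᶠ p in generic k ι, ∀ u, hVector (ann w (∑ j, p j • F j)) u = genericHVector w F u := by
  have hsum (p : ι → k) : (∑ j, p j • F j).IsHomogeneous e :=
    IsHomogeneous.sum _ _ _ fun j _ => (homogeneousSubmodule (Fin r) k e).smul_mem _ (hF j)
  have hrank : ∀ᶠ p in generic k ι, ∀ u ∈ Set.Iic e,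
      finrank k (LinearMap.range (∑ j, p j • catalecticant w u (F j))) =
        maxRank fun j => catalecticant w u (F j) :=
    (Filter.eventually_all_finite (Set.finite_Iic e)).2 fun u _ =>
      eventually_finrank_range_eq_maxRank _
  filter_upwards [hrank] with p hp u
  obtain hu | hu := le_or_gt u e
  · rw [hVector_ann_sum_smul, hp u hu, genericHVector_eq_maxRank]
  · simp only [genericHVector, hVector_ann_eq_zero (hsum _) hu, ciSup_const]

theorem IsLevel.hVector_add_hVector_le [Infinite k] (hw : w.Admissible k e) (hI : IsLevel I e t)
    (F : Basis ι k (inverseSystemPart w I e)) {u : ℕ} (hu : u ≤ e) :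
    hVector I (e - u) + hVector I u ≤
      (Fintype.card ι + 1) * genericHVector w (fun j => (F j).1) u := by
  have hsystem := finrank_add_finrank_iSup_range_le fun j => catalecticant w u (F j).1
  rw [hI.iInf_ker_catalecticant hw F hu, ← genericHVector_eq_maxRank] at hsystem
  have := hVector_add_finrank_homogeneousPart I u
  have := hVector_le_finrank_iSup_range_catalecticant hw (fun j => (F j).2.2)
    (Nat.add_sub_of_le hu) (hI.iInf_ker_catalecticant hw F (Nat.sub_le e u)).le
  omega

theorem IsLevel.isGenericGorensteinHVector_genericHVector [Infinite k] (hw : w.Admissible k e)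
    (hI : IsLevel I e t) (F : Basis (Fin t) k (inverseSystemPart w I e)) :
    IsGenericGorensteinHVector w I e (fun j => (F j).1) (genericHVector w fun j => (F j).1) := by
  have := hI.nonempty_index_of_basis hw F
  have hF (j : Fin t) : (F j).1.IsHomogeneous e := (F j).2.2
  have hindep : LinearIndependent k fun j => (F j).1 :=
    F.linearIndependent.map' (inverseSystemPart w I e).subtype (Submodule.ker_subtype _)
  obtain ⟨U, hU, hne, hgeneric⟩ :=
    exists_isZariskiOpen (eventually_hVector_ann_eq_genericHVector w hF)
  exact ⟨U, hU, hne, fun p hp => ⟨le_ann_formAt p fun j => (F j).2.1,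
    isGorenstein_ann hw (isHomogeneous_formAt p hF) (formAt_ne_zero p hindep), hgeneric p hp⟩⟩

end GenericQuotient

end LevelAlgebra

theorem corollary2p5 {k : Type*} [Field k] [Infinite k] {r e t : ℕ}
    (w : LevelAlgebra.ActionKind)
    (hw : w = LevelAlgebra.ActionKind.differentiation → ringChar k = 0 ∨ e < ringChar k)
    (I : Ideal (MvPolynomial (Fin r) k)) (hI : LevelAlgebra.IsLevel I e t)
    (F : Module.Basis (Fin t) k (LevelAlgebra.inverseSystemPart w I e)) :
    (∃! H : ℕ → ℕ, LevelAlgebra.IsGenericGorensteinHVector w I e (fun j => (F j).1) H) ∧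
    ∀ H : ℕ → ℕ, LevelAlgebra.IsGenericGorensteinHVector w I e (fun j => (F j).1) H →
      ∀ u : ℕ, 1 ≤ u → u ≤ e →
        ((LevelAlgebra.hVector I (e - u) : ℚ) + LevelAlgebra.hVector I u) / (t + 1) ≤ H u := by
  have hgeneric := hI.isGenericGorensteinHVector_genericHVector hw F
  refine ⟨⟨_, hgeneric, fun H hH => hH.unique hgeneric⟩, fun H hH u _ hu => ?_⟩
  have hle := hI.hVector_add_hVector_le hw F hu
  rw [← hH.unique hgeneric, Fintype.card_fin] at hle
  rw [div_le_iff₀ (by positivity), mul_comm]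
  exact_mod_cast hle
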